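/- For point sets $\mathcal H_1,\mathcal H_2\subset\mathbb R^2$, let $T(\mathcal H_1,\mathcal H_2,\mathcal H_2)$ denote the set of straight lines $l$ for which there exist three distinct points $P_1\in l\cap\mathcal H_1$ and $P_2,P_3\in l\cap\mathcal H_2$. A non-degenerate conic is the zero set in $\mathbb R^2$ of a quadratic polynomial $ax^2+2bxy+cy^2+2dx+2ey+f$ with real coefficients such that $$\det\begin{pmatrix}a&b&d\\ b&c&e\\ d&e&f\end{pmatrix}\neq 0 .$$ Theorem. For every real $C>1$ there is a constant $c^*=c^*(C)>0$ with the following property. Let $n$ be a natural number and let $\mathcal H_1,\mathcal H_2\subset\mathbb R^2$ be finite sets such that (a) $n\le|\mathcal H_1|\le Cn$ and $n\le|\mathcal H_2|\le Cn$; (b) $\mathcal H_2$ lies on a non-degenerate conic which contains no point of $\mathcal H_1$; (c) $|T(\mathcal H_1,\mathcal H_2,\mathcal H_2)|\ge n^2$. Then $\mathcal H_1$ has a collinear subset with at least $c^*n$ points. -/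

import Mathlib

/-- The real plane `ℝ²`. -/
abbrev Plane : Type := EuclideanSpace ℝ (Fin 2)

/-- A straight line of the plane: a nonempty affine subspace of dimension one. -/
def IsStraightLine (l : AffineSubspace ℝ Plane) : Prop :=
  (l : Set Plane).Nonempty ∧ Module.finrank ℝ l.direction = 1

/-- The set of triple lines of `A`, `B`, `D`: the straight lines `l` for which there are three
distinct points `P₁ ∈ l ∩ A`, `P₂ ∈ l ∩ B`, `P₃ ∈ l ∩ D`. This is a set of lines, not of triples.
The sets `A`, `B`, `D` may coincide. -/
def tripleLines (A B D : Set Plane) : Set (AffineSubspace ℝ Plane) :=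
  {l | IsStraightLine l ∧
    ∃ P₁ ∈ A, ∃ P₂ ∈ B, ∃ P₃ ∈ D, P₁ ≠ P₂ ∧ P₁ ≠ P₃ ∧ P₂ ≠ P₃ ∧ P₁ ∈ l ∧ P₂ ∈ l ∧ P₃ ∈ l}

/-- The value at `p = (x, y)` of the quadratic polynomial with symmetric coefficient matrix `M`,
that is `(x, y, 1) M (x, y, 1)ᵀ`. -/
def conicEval (M : Matrix (Fin 3) (Fin 3) ℝ) (p : Plane) : ℝ :=
  ![p 0, p 1, 1] ⬝ᵥ (Matrix.mulVec M ![p 0, p 1, 1])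

/-- A non-degenerate conic: the zero set in `ℝ²` of a quadratic polynomial
`a x² + 2 b x y + c y² + 2 d x + 2 e y + f` whose symmetric `3 × 3` coefficient matrix is
invertible. (The quadratic part is then automatically nonzero.) -/
def IsNondegenerateConic (Γ : Set Plane) : Prop :=
  ∃ M : Matrix (Fin 3) (Fin 3) ℝ, M.IsSymm ∧ M.det ≠ 0 ∧ Γ = {p | conicEval M p = 0}

/-! A point $P$ off the conic acts on the conic as an involution: $x$ goes to the second
intersection of the line $Px$ with the conic. When the conic is parametrized by the projective line,
$P$ becomes a non-degenerate binary quadratic form and the involution is orthogonality for its polar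
form. Every triple line yields an incidence $(P,x,y)$, so there are at least $n^2$ incidences.
Cauchy–Schwarz over the common point $y$ (`sq_card_polarIncidences_le`) gives at least
$n^4/|\mathcal H_2|$ chains in which $P$ takes $x$ to $y$ and $Q$ takes $y$ to $z$.

For $P\ne Q$ the map $x\mapsto z$ is a projective transformation, hence monotone on boundedly many
pieces. Cut $\mathcal H_2$ into consecutive blocks of at most $s$ points. The pairs $(x,z)$ of the
chains then meet only $O(|\mathcal H_2|/s+1)$ products of two blocks
(`card_cells_linkedTriples_le`), and apart from two chains per such cell, all chains are paid for by
triples of chains in one cell. There are at most $s^4|\mathcal H_2|^2$ possible endpoints for such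
triples.

Three values determine a projective transformation, and the composition of the involutions of $P$
and $Q$ determines the line $PQ$ (`det3_eq_zero_of_comp`); given $P$, it also determines $Q$. So
each system of endpoints serves at most $m$ pairs $(P,Q)$, where $m$ is the largest size of a
collinear subset of $\mathcal H_1$ (`card_cellTriples_fiber_le`). Hence, with $N=|\mathcal H_2|$ and
$G=|\mathcal H_1|$, $n^4\le N\,(GN+16G^2(N/s+1)+m s^4N^2)$. A large $s$ depending only on $C$ makes
the part with $N/s$ harmless, which leaves $m\ge c^*n$. -/

/-! ### Involutions of the projective line and their compositions -/

/-- The polarization of the binary quadratic form `q.1 X² + 2 q.2.1 X Y + q.2.2 Y²`. -/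
def binaryPolar (q : ℝ × ℝ × ℝ) (x y : ℝ × ℝ) : ℝ :=
  q.1 * (x.1 * y.1) + q.2.1 * (x.1 * y.2 + x.2 * y.1) + q.2.2 * (x.2 * y.2)

/-- The determinant of a binary quadratic form. -/
def binaryDisc (q : ℝ × ℝ × ℝ) : ℝ := q.1 * q.2.2 - q.2.1 ^ 2

/-- The determinant of two vectors of the plane. -/
def wedge (x y : ℝ × ℝ) : ℝ := x.1 * y.2 - x.2 * y.1

/-- The vector orthogonal to `x` for the form `q`. -/
def orthVec (q : ℝ × ℝ × ℝ) (x : ℝ × ℝ) : ℝ × ℝ :=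
  (-(q.2.1 * x.1 + q.2.2 * x.2), q.1 * x.1 + q.2.1 * x.2)

/-- The determinant of three triples. -/
def det3 (p q r : ℝ × ℝ × ℝ) : ℝ :=
  p.1 * (q.2.1 * r.2.2 - q.2.2 * r.2.1) - p.2.1 * (q.1 * r.2.2 - q.2.2 * r.1)
    + p.2.2 * (q.1 * r.2.1 - q.2.1 * r.1)

lemma wedge_orthVec (q : ℝ × ℝ × ℝ) (x y : ℝ × ℝ) :
    wedge (orthVec q x) y = -binaryPolar q x y := by
  simp only [wedge, orthVec, binaryPolar]; ring

lemma binaryPolar_comm (q : ℝ × ℝ × ℝ) (x y : ℝ × ℝ) :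
    binaryPolar q x y = binaryPolar q y x := by
  simp only [binaryPolar]; ring

lemma exists_smul_of_wedge_eq_zero {x y : ℝ × ℝ} (hy : y ≠ 0) (h : wedge x y = 0) :
    ∃ μ : ℝ, x = μ • y := by
  simp only [wedge] at h
  by_cases h1 : y.1 = 0
  · have h2 : y.2 ≠ 0 := fun h2 => hy (Prod.ext h1 h2)
    refine ⟨x.2 / y.2, Prod.ext ?_ ?_⟩
    · simp only [Prod.smul_fst, smul_eq_mul, h1, mul_zero]
      simpa [h1, h2] using h
    · simp [h2]
  · refine ⟨x.1 / y.1, Prod.ext ?_ ?_⟩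
    · simp [h1]
    · simp only [Prod.smul_snd, smul_eq_mul]
      field_simp
      linarith

lemma wedge_eq_zero_trans {x y z : ℝ × ℝ} (hy : y ≠ 0) (h : wedge x y = 0) (h' : wedge z y = 0) :
    wedge x z = 0 := by
  obtain ⟨μ, rfl⟩ := exists_smul_of_wedge_eq_zero hy h
  obtain ⟨ν, rfl⟩ := exists_smul_of_wedge_eq_zero hy h'
  simp only [wedge, Prod.smul_fst, Prod.smul_snd, smul_eq_mul]; ring

lemma orthVec_ne_zero {q : ℝ × ℝ × ℝ} (hq : binaryDisc q ≠ 0) {x : ℝ × ℝ} (hx : x ≠ 0) :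
    orthVec q x ≠ 0 := by
  intro h
  have h1 : q.2.1 * x.1 + q.2.2 * x.2 = 0 := neg_eq_zero.1 (congrArg Prod.fst h)
  have h2 : q.1 * x.1 + q.2.1 * x.2 = 0 := congrArg Prod.snd h
  apply hx
  refine Prod.ext ?_ ?_
  · have : binaryDisc q * x.1 = 0 := by
      simp only [binaryDisc]; linear_combination q.2.2 * h2 - q.2.1 * h1
    simpa [hq] using this
  · have : binaryDisc q * x.2 = 0 := by
      simp only [binaryDisc]; linear_combination q.1 * h1 - q.2.1 * h2
    simpa [hq] using this

/-- The vector orthogonal to `x` is unique up to proportionality. -/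
lemma wedge_eq_zero_of_binaryPolar {q : ℝ × ℝ × ℝ} (hq : binaryDisc q ≠ 0) {x y y' : ℝ × ℝ}
    (hx : x ≠ 0) (h : binaryPolar q x y = 0) (h' : binaryPolar q x y' = 0) : wedge y y' = 0 := by
  have h1 : wedge y (orthVec q x) = 0 := by
    have := wedge_orthVec q x y
    simp only [wedge] at this ⊢; linarith
  have h2 : wedge y' (orthVec q x) = 0 := by
    have := wedge_orthVec q x y'
    simp only [wedge] at this ⊢; linarith
  exact wedge_eq_zero_trans (orthVec_ne_zero hq hx) h1 h2

/-- Since `orthVec p` represents the involution of `p`, the point reached from `x` by the two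
involutions in turn is given by a linear map. -/
lemma wedge_orthVec_comp {p q : ℝ × ℝ × ℝ} {x y z : ℝ × ℝ} (hy : y ≠ 0)
    (h : binaryPolar p x y = 0) (h' : binaryPolar q y z = 0) :
    wedge (orthVec q (orthVec p x)) z = 0 := by
  obtain ⟨μ, hμ⟩ := exists_smul_of_wedge_eq_zero hy ((wedge_orthVec p x y).trans (by simp [h]))
  have := wedge_orthVec q y z
  rw [hμ]
  simp only [wedge, orthVec, Prod.smul_fst, Prod.smul_snd, smul_eq_mul] at this ⊢
  linear_combination μ * this - μ * h'

/-- A binary quadratic form with three distinct projective zeros vanishes. -/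
lemma binary_coeffs_eq_zero {a b c : ℝ} {x y z : ℝ × ℝ} (hxy : wedge x y ≠ 0) (hxz : wedge x z ≠ 0)
    (hyz : wedge y z ≠ 0) (hx : a * x.1 ^ 2 + b * (x.1 * x.2) + c * x.2 ^ 2 = 0)
    (hy : a * y.1 ^ 2 + b * (y.1 * y.2) + c * y.2 ^ 2 = 0)
    (hz : a * z.1 ^ 2 + b * (z.1 * z.2) + c * z.2 ^ 2 = 0) : a = 0 ∧ b = 0 ∧ c = 0 := by
  have hne : wedge x y * wedge x z * wedge y z ≠ 0 := by positivity
  simp only [wedge] at hne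
  refine ⟨?_, ?_, ?_⟩
  · refine (mul_eq_zero.1 (?_ : a * _ = 0)).resolve_right hne
    linear_combination (y.2 * z.2 * (y.1 * z.2 - y.2 * z.1)) * hx
      - (x.2 * z.2 * (x.1 * z.2 - x.2 * z.1)) * hy + (x.2 * y.2 * (x.1 * y.2 - x.2 * y.1)) * hz
  · refine (mul_eq_zero.1 (?_ : b * _ = 0)).resolve_right hne
    linear_combination (-(y.1 * z.2 + y.2 * z.1) * (y.1 * z.2 - y.2 * z.1)) * hx
      + ((x.1 * z.2 + x.2 * z.1) * (x.1 * z.2 - x.2 * z.1)) * hy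
      - ((x.1 * y.2 + x.2 * y.1) * (x.1 * y.2 - x.2 * y.1)) * hz
  · refine (mul_eq_zero.1 (?_ : c * _ = 0)).resolve_right hne
    linear_combination (y.1 * z.1 * (y.1 * z.2 - y.2 * z.1)) * hx
      - (x.1 * z.1 * (x.1 * z.2 - x.2 * z.1)) * hy + (x.1 * y.1 * (x.1 * y.2 - x.2 * y.1)) * hz

/-- Two linear maps of the plane, the second one invertible, which agree projectively at three
points are proportional. -/
lemma exists_smul_of_wedge_three {t₁ t₂ t₃ t₄ u₁ u₂ u₃ u₄ : ℝ} (hu : u₁ * u₄ - u₂ * u₃ ≠ 0)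
    {x y z : ℝ × ℝ} (hxy : wedge x y ≠ 0) (hxz : wedge x z ≠ 0) (hyz : wedge y z ≠ 0)
    (h : ∀ v ∈ ({x, y, z} : Set (ℝ × ℝ)),
      wedge (t₁ * v.1 + t₂ * v.2, t₃ * v.1 + t₄ * v.2) (u₁ * v.1 + u₂ * v.2, u₃ * v.1 + u₄ * v.2)
        = 0) :
    ∃ μ : ℝ, t₁ = μ * u₁ ∧ t₂ = μ * u₂ ∧ t₃ = μ * u₃ ∧ t₄ = μ * u₄ := by
  have key := binary_coeffs_eq_zero (a := t₁ * u₃ - t₃ * u₁)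
    (b := t₁ * u₄ + t₂ * u₃ - t₃ * u₂ - t₄ * u₁) (c := t₂ * u₄ - t₄ * u₂) hxy hxz hyz
    (by have := h x (by simp); simp only [wedge] at this; linear_combination this)
    (by have := h y (by simp); simp only [wedge] at this; linear_combination this)
    -- The form $v\mapsto Tv\wedge Uv$ has three projective zeros, so it vanishes identically; the
    -- witness below is then an entry of the scalar matrix $U^{-1}T$.
    (by have := h z (by simp); simp only [wedge] at this; linear_combination this)
  obtain ⟨ha, hb, hc⟩ := key
  refine ⟨(t₁ * u₄ - t₃ * u₂) / (u₁ * u₄ - u₂ * u₃), ?_, ?_, ?_, ?_⟩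
  · rw [div_mul_eq_mul_div, eq_div_iff hu]; linear_combination (-u₂) * ha
  · rw [div_mul_eq_mul_div, eq_div_iff hu]; linear_combination (-u₂) * hb + u₁ * hc
  · rw [div_mul_eq_mul_div, eq_div_iff hu]; linear_combination (-u₄) * ha
  · rw [div_mul_eq_mul_div, eq_div_iff hu]; linear_combination (-u₄) * hb + u₃ * hc

lemma orthVec_orthVec (p q : ℝ × ℝ × ℝ) (x : ℝ × ℝ) :
    orthVec q (orthVec p x) =
      ((q.2.1 * p.2.1 - q.2.2 * p.1) * x.1 + (q.2.1 * p.2.2 - q.2.2 * p.2.1) * x.2,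
        (q.2.1 * p.1 - q.1 * p.2.1) * x.1 + (q.2.1 * p.2.1 - q.1 * p.2.2) * x.2) := by
  simp only [orthVec]; refine Prod.ext ?_ ?_ <;> simp <;> ring

/-- The two composed maps agree at three points of the projective line, so their matrices are
proportional; the four equations compare the entries. -/
lemma exists_comp_smul {p q p' q' : ℝ × ℝ × ℝ} (hp' : binaryDisc p' ≠ 0) (hq' : binaryDisc q' ≠ 0)
    {x z y y' : Fin 3 → ℝ × ℝ} (hx : ∀ i j, i ≠ j → wedge (x i) (x j) ≠ 0)
    (hy : ∀ i, y i ≠ 0) (hy' : ∀ i, y' i ≠ 0) (hz : ∀ i, z i ≠ 0)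
    (hp : ∀ i, binaryPolar p (x i) (y i) = 0) (hq : ∀ i, binaryPolar q (y i) (z i) = 0)
    (hp2 : ∀ i, binaryPolar p' (x i) (y' i) = 0) (hq2 : ∀ i, binaryPolar q' (y' i) (z i) = 0) :
    ∃ μ : ℝ, (q.2.1 * p.2.1 - q.2.2 * p.1) = μ * (q'.2.1 * p'.2.1 - q'.2.2 * p'.1) ∧
      (q.2.1 * p.2.2 - q.2.2 * p.2.1) = μ * (q'.2.1 * p'.2.2 - q'.2.2 * p'.2.1) ∧
      (q.2.1 * p.1 - q.1 * p.2.1) = μ * (q'.2.1 * p'.1 - q'.1 * p'.2.1) ∧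
      (q.2.1 * p.2.1 - q.1 * p.2.2) = μ * (q'.2.1 * p'.2.1 - q'.1 * p'.2.2) := by
  have main : ∀ i, wedge (orthVec q (orthVec p (x i))) (orthVec q' (orthVec p' (x i))) = 0 :=
    fun i => wedge_eq_zero_trans (hz i) (wedge_orthVec_comp (hy i) (hp i) (hq i))
      (wedge_orthVec_comp (hy' i) (hp2 i) (hq2 i))
  refine exists_smul_of_wedge_three ?_ (hx 0 1 (by decide)) (hx 0 2 (by decide))
    (hx 1 2 (by decide)) ?_
  · have : binaryDisc p' * binaryDisc q' ≠ 0 := mul_ne_zero hp' hq'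
    intro h; apply this; rw [← h]; simp only [binaryDisc]; ring
  · intro v hv
    rw [← orthVec_orthVec, ← orthVec_orthVec]
    rcases hv with rfl | rfl | rfl <;> apply main

/-- If the composed involutions of `(p, q)` and `(p', q')` agree at three points, then `p'` lies on
the line of `p` and `q`. -/
lemma det3_eq_zero_of_comp {p q p' q' : ℝ × ℝ × ℝ} (hp' : binaryDisc p' ≠ 0)
    (hq' : binaryDisc q' ≠ 0)
    {x z y y' : Fin 3 → ℝ × ℝ} (hx : ∀ i j, i ≠ j → wedge (x i) (x j) ≠ 0)
    (hy : ∀ i, y i ≠ 0) (hy' : ∀ i, y' i ≠ 0) (hz : ∀ i, z i ≠ 0)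
    (hp : ∀ i, binaryPolar p (x i) (y i) = 0) (hq : ∀ i, binaryPolar q (y i) (z i) = 0)
    (hp2 : ∀ i, binaryPolar p' (x i) (y' i) = 0) (hq2 : ∀ i, binaryPolar q' (y' i) (z i) = 0) :
    det3 p' p q = 0 := by
  obtain ⟨μ, h1, h2, h3, h4⟩ := exists_comp_smul hp' hq' hx hy hy' hz hp hq hp2 hq2
  simp only [det3]
  -- The entries $t_2$, $t_3$ and $t_1-t_4$ of the composition are the $2\times2$ minors of `p` and
  -- `q` up to sign, and the corresponding minors of `p'` and `q'` are orthogonal to `p'`.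
  linear_combination (-p'.1) * h2 - p'.2.2 * h3 * (-1) + p'.2.1 * (h1 - h4)

/-- The first involution can be cancelled because its matrix is invertible; what remains determines
the second form up to a factor. -/
lemma exists_smul_of_comp {p q q' : ℝ × ℝ × ℝ} (hp : binaryDisc p ≠ 0)
    (hq' : binaryDisc q' ≠ 0)
    {x z y y' : Fin 3 → ℝ × ℝ} (hx : ∀ i j, i ≠ j → wedge (x i) (x j) ≠ 0)
    (hy : ∀ i, y i ≠ 0) (hy' : ∀ i, y' i ≠ 0) (hz : ∀ i, z i ≠ 0)
    (h1 : ∀ i, binaryPolar p (x i) (y i) = 0) (h2 : ∀ i, binaryPolar q (y i) (z i) = 0)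
    (h3 : ∀ i, binaryPolar p (x i) (y' i) = 0) (h4 : ∀ i, binaryPolar q' (y' i) (z i) = 0) :
    ∃ μ : ℝ, q = μ • q' := by
  obtain ⟨μ, e1, e2, e3, e4⟩ := exists_comp_smul hp hq' hx hy hy' hz h1 h2 h3 h4
  have hd : p.1 * p.2.2 - p.2.1 ^ 2 ≠ 0 := hp
  refine ⟨μ, Prod.ext ?_ (Prod.ext ?_ ?_)⟩ <;>
    simp only [Prod.smul_fst, Prod.smul_snd, smul_eq_mul] <;>
    refine mul_right_cancel₀ hd ?_
  · linear_combination p.2.1 * e3 - p.1 * e4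
  · linear_combination p.2.2 * e3 - p.2.1 * e4
  · linear_combination p.2.1 * e2 - p.2.2 * e1

/-! ### Chains, cells and blocks -/

/-- The points of a chain in `ℕ × ℕ` with coordinates below `B` number at most `2 * B`. -/
lemma card_image_le_of_monotone {ι : Type*} (W : Finset ι) (f g : ι → ℕ) (B : ℕ)
    (hf : ∀ w ∈ W, f w < B) (hg : ∀ w ∈ W, g w < B)
    (h : ∀ w ∈ W, ∀ w' ∈ W, (f w ≤ f w' ∧ g w ≤ g w') ∨ (f w' ≤ f w ∧ g w' ≤ g w)) :
    (W.image fun w => (f w, g w)).card ≤ 2 * B := by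
  rw [← Finset.card_range (2 * B)]
  refine Finset.card_le_card_of_injOn (fun c => c.1 + c.2) ?_ ?_
  · intro c hc
    simp only [Finset.coe_image, Set.mem_image, Finset.mem_coe] at hc
    obtain ⟨w, hw, rfl⟩ := hc
    have := hf w hw; have := hg w hw
    simp only [Finset.coe_range, Set.mem_Iio]; omega
  · intro c hc c' hc' he
    simp only [Finset.coe_image, Set.mem_image, Finset.mem_coe] at hc hc'
    obtain ⟨w, hw, rfl⟩ := hc
    obtain ⟨w', hw', rfl⟩ := hc'
    have := h w hw w' hw'
    simp only [Prod.mk.injEq] at he ⊢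
    omega

lemma card_image_le_of_antitone {ι : Type*} (W : Finset ι) (f g : ι → ℕ) (B : ℕ)
    (hf : ∀ w ∈ W, f w < B) (hg : ∀ w ∈ W, g w < B)
    (h : ∀ w ∈ W, ∀ w' ∈ W, (f w ≤ f w' ∧ g w' ≤ g w) ∨ (f w' ≤ f w ∧ g w ≤ g w')) :
    (W.image fun w => (f w, g w)).card ≤ 2 * B := by
  rw [← Finset.card_range (2 * B)]
  refine Finset.card_le_card_of_injOn (fun c => c.1 + (B - c.2)) ?_ ?_
  · intro c hc
    simp only [Finset.coe_image, Set.mem_image, Finset.mem_coe] at hc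
    obtain ⟨w, hw, rfl⟩ := hc
    have := hf w hw; have := hg w hw
    simp only [Finset.coe_range, Set.mem_Iio]; omega
  · intro c hc c' hc' he
    simp only [Finset.coe_image, Set.mem_image, Finset.mem_coe] at hc hc'
    obtain ⟨w, hw, rfl⟩ := hc
    obtain ⟨w', hw', rfl⟩ := hc'
    have := h w hw w' hw'
    have := hg w hw; have := hg w' hw'
    simp only [Prod.mk.injEq] at he ⊢
    omega

/-- If `W` is distributed over `k` cells, then all but `2 * k` of its elements are accounted for by
triples of distinct elements of a common cell. -/
lemma card_le_two_mul_add_card_triples {ι κ : Type*} [DecidableEq ι] [DecidableEq κ]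
    (W : Finset ι) (cell : ι → κ) (k : ℕ) (hk : (W.image cell).card ≤ k) :
    W.card ≤ 2 * k + ((W ×ˢ W ×ˢ W).filter fun w => w.1 ≠ w.2.1 ∧ w.1 ≠ w.2.2 ∧ w.2.1 ≠ w.2.2 ∧
      cell w.1 = cell w.2.1 ∧ cell w.1 = cell w.2.2).card := by
  set T := (W ×ˢ W ×ˢ W).filter fun w => w.1 ≠ w.2.1 ∧ w.1 ≠ w.2.2 ∧ w.2.1 ≠ w.2.2 ∧
      cell w.1 = cell w.2.1 ∧ cell w.1 = cell w.2.2 with hT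
  have hW : W.card = ∑ c ∈ W.image cell, (W.filter fun w => cell w = c).card :=
    Finset.card_eq_sum_card_fiberwise fun w hw => by
      simpa using ⟨w, hw, rfl⟩
  have hTc : T.card = ∑ c ∈ W.image cell, (T.filter fun w => cell w.1 = c).card :=
    Finset.card_eq_sum_card_fiberwise fun w hw => by
      simp only [hT, Finset.coe_filter, Finset.mem_product, Set.mem_ofPred_eq] at hw
      simpa using ⟨w.1, hw.1.1, rfl⟩
  have hfib : ∀ c, (W.filter fun w => cell w = c).card ≤
      2 + (T.filter fun w => cell w.1 = c).card := by
    intro c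
    set F := W.filter fun w => cell w = c with hF
    by_cases h2 : F.card ≤ 1
    · omega
    obtain ⟨p, hp, q, hq, hpq⟩ := Finset.one_lt_card.1 (not_le.1 h2)
    -- Two elements of the cell are kept fixed; every further element completes them to a triple.
    have h3 : ((F.erase p).erase q).card ≤ (T.filter fun w => cell w.1 = c).card := by
      refine Finset.card_le_card_of_injOn (fun w => (p, q, w)) ?_ ?_
      · intro w hw
        simp only [Finset.coe_erase, Set.mem_sdiff, Finset.mem_coe, Set.mem_singleton_iff, hF,
          Finset.mem_filter] at hw hp hq
        simp only [hT, Finset.coe_filter, Finset.mem_filter, Finset.mem_product, Set.mem_ofPred_eq]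
        refine ⟨⟨⟨hp.1, hq.1, hw.1.1.1⟩, hpq, Ne.symm hw.1.2, Ne.symm hw.2, ?_, ?_⟩, hp.2⟩
        · rw [hp.2, hq.2]
        · rw [hp.2, hw.1.1.2]
      · intro w _ w' _ h
        simpa using h
    have h4 := Finset.pred_card_le_card_erase (s := F.erase p) (a := q)
    have h5 := Finset.pred_card_le_card_erase (s := F) (a := p)
    omega
  calc W.card = ∑ c ∈ W.image cell, (W.filter fun w => cell w = c).card := hW
    _ ≤ ∑ c ∈ W.image cell, (2 + (T.filter fun w => cell w.1 = c).card) :=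
        Finset.sum_le_sum fun c _ => hfib c
    _ = 2 * (W.image cell).card + T.card := by
        rw [Finset.sum_add_distrib, ← hTc, Finset.sum_const, smul_eq_mul, mul_comm]
    _ ≤ 2 * k + T.card := by omega

/-- A finite set that is linearly ordered by a key can be cut into consecutive blocks of
size at most `s`. -/
lemma exists_blocks {β K : Type*} [LinearOrder K] (H : Finset β) (key : β → K)
    (hkey : Set.InjOn key H) (s : ℕ) (hs : 0 < s) :
    ∃ blk : β → ℕ, (∀ x ∈ H, blk x < H.card / s + 1) ∧
      (∀ x y, key x ≤ key y → blk x ≤ blk y) ∧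
      ∀ j, (H.filter fun x => blk x = j).card ≤ s := by
  classical
  have hmono : ∀ x y, key x ≤ key y → (H.filter fun u => key u < key x).card ≤
      (H.filter fun u => key u < key y).card := fun x y h =>
    Finset.card_le_card fun u hu => by
      simp only [Finset.mem_filter] at hu ⊢
      exact ⟨hu.1, hu.2.trans_le h⟩
  have hstrict : ∀ x ∈ H, ∀ y, key x < key y → (H.filter fun u => key u < key x).card <
      (H.filter fun u => key u < key y).card := fun x hx y h =>
    Finset.card_lt_card ⟨fun u hu => by
      simp only [Finset.mem_filter] at hu ⊢
      exact ⟨hu.1, hu.2.trans h⟩, fun hsub => by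
        have := hsub (Finset.mem_filter.2 ⟨hx, h⟩)
        simp at this⟩
  -- The block of `x` is its rank in the order, divided by `s`.
  refine ⟨fun x => (H.filter fun u => key u < key x).card / s, ?_, ?_, ?_⟩
  · intro x _
    exact Nat.lt_succ_of_le (Nat.div_le_div_right (Finset.card_filter_le _ _))
  · intro x y h
    exact Nat.div_le_div_right (hmono x y h)
  · intro j
    calc _ ≤ (Finset.Ico (j * s) (j * s + s)).card := by
          refine Finset.card_le_card_of_injOn (fun x => (H.filter fun u => key u < key x).card)
            ?_ ?_
          · intro x hx
            simp only [Finset.coe_filter, Set.mem_ofPred_eq] at hx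
            simp only [Finset.coe_Ico, Set.mem_Ico]
            obtain ⟨_, h⟩ := hx
            have h1 := Nat.div_mul_le_self (H.filter fun u => key u < key x).card s
            have h2 := Nat.lt_div_mul_add (a := (H.filter fun u => key u < key x).card) hs
            rw [h] at h1 h2
            exact ⟨h1, h2⟩
          · intro x hx y hy h
            simp only [Finset.coe_filter, Set.mem_ofPred_eq] at hx hy
            rcases lt_trichotomy (key x) (key y) with hlt | heq | hlt
            · exact absurd h (hstrict x hx.1 y hlt).ne
            · exact hkey hx.1 hy.1 heq
            · exact absurd h (hstrict y hy.1 x hlt).ne'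
      _ = s := by simp

/-! ### Monotonicity of projective transformations -/

/-- The affine coordinate of a point of the projective line, `⊥` being the point at infinity. -/
noncomputable def slopeKey (x : ℝ × ℝ) : WithBot ℝ :=
  if x.1 = 0 then ⊥ else ((x.2 / x.1 : ℝ) : WithBot ℝ)

lemma wedge_eq_zero_of_slopeKey_eq {x y : ℝ × ℝ} (h : slopeKey x = slopeKey y) :
    wedge x y = 0 := by
  unfold slopeKey at h
  simp only [wedge]
  split_ifs at h with h1 h2 h2
  · simp [h1, h2]
  · exact absurd h (by simp)
  · exact absurd h (by simp)
  · have := WithBot.coe_injective h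
    rw [div_eq_div_iff h1 h2] at this
    linarith

lemma slopeKey_eq_of_wedge {u z : ℝ × ℝ} (hu : u ≠ 0) (hz : z.1 ≠ 0) (h : wedge u z = 0) :
    u.1 ≠ 0 ∧ slopeKey z = ((u.2 / u.1 : ℝ) : WithBot ℝ) := by
  simp only [wedge] at h
  have h1 : u.1 ≠ 0 := by
    intro h1
    apply hu
    refine Prod.ext h1 ?_
    simpa [h1, hz] using h
  refine ⟨h1, ?_⟩
  rw [slopeKey, if_neg hz, WithBot.coe_inj, div_eq_div_iff hz h1]
  linarith

/-- The difference of two values of a fractional linear map. -/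
lemma fractional_linear_sub {t₁ t₂ t₃ t₄ : ℝ} {x y : ℝ × ℝ} (hx : x.1 ≠ 0) (hy : y.1 ≠ 0)
    (hx' : t₁ * x.1 + t₂ * x.2 ≠ 0) (hy' : t₁ * y.1 + t₂ * y.2 ≠ 0) :
    (t₃ * y.1 + t₄ * y.2) / (t₁ * y.1 + t₂ * y.2) - (t₃ * x.1 + t₄ * x.2) / (t₁ * x.1 + t₂ * x.2)
      = (t₁ * t₄ - t₂ * t₃) * (y.2 / y.1 - x.2 / x.1) /
        (((t₁ * x.1 + t₂ * x.2) / x.1) * ((t₁ * y.1 + t₂ * y.2) / y.1)) := by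
  rw [div_sub_div _ _ hy' hx', div_sub_div _ _ hy hx, div_mul_div_comm, mul_div_assoc',
    div_div_div_eq, div_eq_div_iff (by positivity) (by positivity)]
  ring

/-- The pieces on which the composition `x ↦ z` of two involutions is monotone. -/
noncomputable def pieceIndex (t₁ t₂ : ℝ) (x z : ℝ × ℝ) : Fin 4 :=
  if x.1 = 0 then 0 else if z.1 = 0 then 1 else if 0 < (t₁ * x.1 + t₂ * x.2) / x.1 then 2 else 3

/-- An invertible linear map acts on the affine coordinate monotonically on each piece. -/
lemma slopeKey_monotone_or_antitone {t₁ t₂ t₃ t₄ : ℝ} (hdet : t₁ * t₄ - t₂ * t₃ ≠ 0)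
    {x z x' z' : ℝ × ℝ} (hx : x ≠ 0) (hx' : x' ≠ 0)
    (hxz : wedge (t₁ * x.1 + t₂ * x.2, t₃ * x.1 + t₄ * x.2) z = 0)
    (hxz' : wedge (t₁ * x'.1 + t₂ * x'.2, t₃ * x'.1 + t₄ * x'.2) z' = 0)
    (hp : pieceIndex t₁ t₂ x z = pieceIndex t₁ t₂ x' z') :
    slopeKey x = slopeKey x' ∨ slopeKey z = slopeKey z' ∨
    (0 < t₁ * t₄ - t₂ * t₃ ∧ (slopeKey x ≤ slopeKey x' ∧ slopeKey z ≤ slopeKey z' ∨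
      slopeKey x' ≤ slopeKey x ∧ slopeKey z' ≤ slopeKey z)) ∨
    (t₁ * t₄ - t₂ * t₃ < 0 ∧ (slopeKey x ≤ slopeKey x' ∧ slopeKey z' ≤ slopeKey z ∨
      slopeKey x' ≤ slopeKey x ∧ slopeKey z ≤ slopeKey z')) := by
  have hne : ∀ v : ℝ × ℝ, v ≠ 0 → ((t₁ * v.1 + t₂ * v.2, t₃ * v.1 + t₄ * v.2) : ℝ × ℝ) ≠ 0 := by
    intro v hv h
    have h1 : t₁ * v.1 + t₂ * v.2 = 0 := congrArg Prod.fst h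
    have h2 : t₃ * v.1 + t₄ * v.2 = 0 := congrArg Prod.snd h
    refine hv (Prod.ext ?_ ?_)
    · exact (mul_eq_zero.1 (by linear_combination t₄ * h1 - t₂ * h2 :
        (t₁ * t₄ - t₂ * t₃) * v.1 = 0)).resolve_left hdet
    · exact (mul_eq_zero.1 (by linear_combination t₁ * h2 - t₃ * h1 :
        (t₁ * t₄ - t₂ * t₃) * v.2 = 0)).resolve_left hdet
  by_cases h1 : x.1 = 0
  · have h1' : x'.1 = 0 := by
      by_contra h
      simp only [pieceIndex, h1, h, if_true, if_false] at hp
      split_ifs at hp <;> exact absurd hp (by decide)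
    left; simp [slopeKey, h1, h1']
  have h1' : x'.1 ≠ 0 := by
    intro h
    simp only [pieceIndex, h1, h, if_true, if_false] at hp
    split_ifs at hp <;> exact absurd hp (by decide)
  by_cases h2 : z.1 = 0
  · have h2' : z'.1 = 0 := by
      by_contra h
      simp only [pieceIndex, h1, h1', h2, h, if_true, if_false] at hp
      split_ifs at hp <;> exact absurd hp (by decide)
    right; left; simp [slopeKey, h2, h2']
  have h2' : z'.1 ≠ 0 := by
    intro h
    simp only [pieceIndex, h1, h1', h2, h, if_true, if_false] at hp
    split_ifs at hp <;> exact absurd hp (by decide)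
  right; right
  obtain ⟨h3, h4⟩ := slopeKey_eq_of_wedge (hne x hx) h2 hxz
  obtain ⟨h3', h4'⟩ := slopeKey_eq_of_wedge (hne x' hx') h2' hxz'
  simp only at h3 h3' h4 h4'
  -- Both points lie on the same side of the pole, so the sign of the difference quotient is that of
  -- the determinant.
  have hpos : 0 < ((t₁ * x.1 + t₂ * x.2) / x.1) * ((t₁ * x'.1 + t₂ * x'.2) / x'.1) := by
    simp only [pieceIndex, h1, h1', h2, h2', if_false] at hp
    split_ifs at hp with ha hb hb
    · exact mul_pos ha hb
    · exact absurd hp (by decide)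
    · exact absurd hp (by decide)
    · exact mul_pos_of_neg_of_neg (lt_of_le_of_ne (not_lt.1 ha) (div_ne_zero h3 h1))
        (lt_of_le_of_ne (not_lt.1 hb) (div_ne_zero h3' h1'))
  have hsub := fractional_linear_sub (t₃ := t₃) (t₄ := t₄) h1 h1' h3 h3'
  rw [h4, h4', slopeKey, slopeKey, if_neg h1, if_neg h1']
  simp only [WithBot.coe_le_coe]
  rcases lt_or_gt_of_ne hdet with hd | hd
  · refine Or.inr ⟨hd, ?_⟩
    rcases le_total (x.2 / x.1) (x'.2 / x'.1) with h | h
    · refine Or.inl ⟨h, sub_nonpos.1 ?_⟩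
      rw [hsub]
      exact div_nonpos_of_nonpos_of_nonneg
        (mul_nonpos_of_nonpos_of_nonneg hd.le (sub_nonneg.2 h)) hpos.le
    · refine Or.inr ⟨h, sub_nonneg.1 ?_⟩
      rw [hsub]
      exact div_nonneg (mul_nonneg_of_nonpos_of_nonpos hd.le (sub_nonpos.2 h)) hpos.le
  · refine Or.inl ⟨hd, ?_⟩
    rcases le_total (x.2 / x.1) (x'.2 / x'.1) with h | h
    · refine Or.inl ⟨h, sub_nonneg.1 ?_⟩
      rw [hsub]
      exact div_nonneg (mul_nonneg hd.le (sub_nonneg.2 h)) hpos.le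
    · refine Or.inr ⟨h, sub_nonpos.1 ?_⟩
      rw [hsub]
      exact div_nonpos_of_nonpos_of_nonneg
        (mul_nonpos_of_nonneg_of_nonpos hd.le (sub_nonpos.2 h)) hpos.le

/-! ### Counting chains of two involutions -/

section Counting

variable {α β : Type*}

/-- The triples `(x, y, z)` of `H` for which the involution of `p` takes `x` to `y` and that of `q`
takes `y` to `z`. -/
noncomputable def linkedTriples (H : Finset β) (X : β → ℝ × ℝ) (p q : ℝ × ℝ × ℝ) :
    Finset (β × β × β) :=
  open Classical in (H ×ˢ H ×ˢ H).filter fun w =>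
    binaryPolar p (X w.1) (X w.2.1) = 0 ∧ binaryPolar q (X w.2.1) (X w.2.2) = 0

lemma mem_linkedTriples {H : Finset β} {X : β → ℝ × ℝ} {p q : ℝ × ℝ × ℝ} {w : β × β × β} :
    w ∈ linkedTriples H X p q ↔ (w.1 ∈ H ∧ w.2.1 ∈ H ∧ w.2.2 ∈ H) ∧
      binaryPolar p (X w.1) (X w.2.1) = 0 ∧ binaryPolar q (X w.2.1) (X w.2.2) = 0 := by
  simp [linkedTriples]

lemma eq_of_binaryPolar {H : Finset β} {X : β → ℝ × ℝ} (hX : ∀ x ∈ H, X x ≠ 0)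
    (hXX : ∀ x ∈ H, ∀ y ∈ H, x ≠ y → wedge (X x) (X y) ≠ 0) {p : ℝ × ℝ × ℝ}
    (hp : binaryDisc p ≠ 0) {x y y' : β} (hx : x ∈ H) (hy : y ∈ H) (hy' : y' ∈ H)
    (h : binaryPolar p (X x) (X y) = 0) (h' : binaryPolar p (X x) (X y') = 0) : y = y' := by
  by_contra hne
  exact hXX y hy y' hy' hne (wedge_eq_zero_of_binaryPolar hp (hX x hx) h h')

lemma card_linkedTriples_le {H : Finset β} {X : β → ℝ × ℝ} (hX : ∀ x ∈ H, X x ≠ 0)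
    (hXX : ∀ x ∈ H, ∀ y ∈ H, x ≠ y → wedge (X x) (X y) ≠ 0) {p q : ℝ × ℝ × ℝ}
    (hp : binaryDisc p ≠ 0) (hq : binaryDisc q ≠ 0) :
    (linkedTriples H X p q).card ≤ H.card := by
  refine Finset.card_le_card_of_injOn (fun w => w.1) ?_ ?_
  · intro w hw
    exact (mem_linkedTriples.1 hw).1.1
  · rintro ⟨x, y, z⟩ hw ⟨x', y', z'⟩ hw' h
    obtain ⟨⟨hx, hy, hz⟩, h1, h2⟩ := mem_linkedTriples.1 hw
    obtain ⟨⟨hx', hy', hz'⟩, h1', h2'⟩ := mem_linkedTriples.1 hw'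
    simp only at *
    subst h
    obtain rfl := eq_of_binaryPolar hX hXX hp hx hy hy' h1 h1'
    obtain rfl := eq_of_binaryPolar hX hXX hq hy hz hz' h2 h2'
    rfl

/-- On each of the four pieces the map $x\mapsto z$ is monotone or one coordinate is constant, so
the cells form a chain of at most `2 * B` members. -/
lemma card_cells_linkedTriples_le [DecidableEq β] {H : Finset β} {X : β → ℝ × ℝ} (hX : ∀ x ∈ H, X x ≠ 0)
    {p q : ℝ × ℝ × ℝ} (hp : binaryDisc p ≠ 0) (hq : binaryDisc q ≠ 0) {blk : β → ℕ} {B : ℕ}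
    (hB : ∀ x ∈ H, blk x < B)
    (hmono : ∀ x y, slopeKey (X x) ≤ slopeKey (X y) → blk x ≤ blk y) :
    ((linkedTriples H X p q).image fun w => (blk w.1, blk w.2.2)).card ≤ 8 * B := by
  set t₁ := q.2.1 * p.2.1 - q.2.2 * p.1 with ht₁
  set t₂ := q.2.1 * p.2.2 - q.2.2 * p.2.1 with ht₂
  set t₃ := q.2.1 * p.1 - q.1 * p.2.1 with ht₃
  set t₄ := q.2.1 * p.2.1 - q.1 * p.2.2 with ht₄
  have hdet : t₁ * t₄ - t₂ * t₃ ≠ 0 := by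
    have : t₁ * t₄ - t₂ * t₃ = binaryDisc p * binaryDisc q := by
      simp only [binaryDisc, ht₁, ht₂, ht₃, ht₄]; ring
    rw [this]; exact mul_ne_zero hp hq
  have hT : ∀ w ∈ linkedTriples H X p q,
      wedge (t₁ * (X w.1).1 + t₂ * (X w.1).2, t₃ * (X w.1).1 + t₄ * (X w.1).2) (X w.2.2) = 0 := by
    intro w hw
    obtain ⟨⟨hx, hy, hz⟩, h1, h2⟩ := mem_linkedTriples.1 hw
    have := wedge_orthVec_comp (hX _ hy) h1 h2
    rwa [orthVec_orthVec] at this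
  have hsub : ((linkedTriples H X p q).image fun w => (blk w.1, blk w.2.2)) ⊆
      (Finset.univ : Finset (Fin 4)).biUnion fun i =>
        ((linkedTriples H X p q).filter fun w => pieceIndex t₁ t₂ (X w.1) (X w.2.2) = i).image
          fun w => (blk w.1, blk w.2.2) := by
    intro c hc
    obtain ⟨w, hw, rfl⟩ := Finset.mem_image.1 hc
    exact Finset.mem_biUnion.2 ⟨_, Finset.mem_univ _,
      Finset.mem_image.2 ⟨w, Finset.mem_filter.2 ⟨hw, rfl⟩, rfl⟩⟩
  refine (Finset.card_le_card hsub).trans ((Finset.card_biUnion_le_card_mul _ _ (2 * B) ?_).trans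
    (by simp; omega))
  intro i _
  have hf : ∀ w ∈ (linkedTriples H X p q).filter
      (fun w => pieceIndex t₁ t₂ (X w.1) (X w.2.2) = i), blk w.1 < B := fun w hw =>
    hB _ (mem_linkedTriples.1 (Finset.mem_filter.1 hw).1).1.1
  have hg : ∀ w ∈ (linkedTriples H X p q).filter
      (fun w => pieceIndex t₁ t₂ (X w.1) (X w.2.2) = i), blk w.2.2 < B := fun w hw =>
    hB _ (mem_linkedTriples.1 (Finset.mem_filter.1 hw).1).1.2.2
  have hcmp : ∀ w ∈ (linkedTriples H X p q).filter
      (fun w => pieceIndex t₁ t₂ (X w.1) (X w.2.2) = i),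
      ∀ w' ∈ (linkedTriples H X p q).filter
      (fun w => pieceIndex t₁ t₂ (X w.1) (X w.2.2) = i), _ := fun w hw w' hw' =>
    slopeKey_monotone_or_antitone hdet
      (hX _ (mem_linkedTriples.1 (Finset.mem_filter.1 hw).1).1.1)
      (hX _ (mem_linkedTriples.1 (Finset.mem_filter.1 hw').1).1.1)
      (hT w (Finset.mem_filter.1 hw).1) (hT w' (Finset.mem_filter.1 hw').1)
      ((Finset.mem_filter.1 hw).2.trans (Finset.mem_filter.1 hw').2.symm)
  rcases lt_or_gt_of_ne hdet with hd | hd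
  · refine card_image_le_of_antitone _ (fun w : β × β × β => blk w.1)
      (fun w => blk w.2.2) B hf hg ?_
    intro w hw w' hw'
    rcases hcmp w hw w' hw' with h | h | ⟨h, -⟩ | ⟨-, ⟨h, h'⟩ | ⟨h, h'⟩⟩
    · have := hmono _ _ h.le; have := hmono _ _ h.ge; omega
    · have := hmono _ _ h.le; have := hmono _ _ h.ge; omega
    · exact absurd h hd.not_gt
    · exact Or.inl ⟨hmono _ _ h, hmono _ _ h'⟩
    · exact Or.inr ⟨hmono _ _ h, hmono _ _ h'⟩
  · refine card_image_le_of_monotone _ (fun w : β × β × β => blk w.1)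
      (fun w => blk w.2.2) B hf hg ?_
    intro w hw w' hw'
    rcases hcmp w hw w' hw' with h | h | ⟨-, ⟨h, h'⟩ | ⟨h, h'⟩⟩ | ⟨h, -⟩
    · have := hmono _ _ h.le; have := hmono _ _ h.ge; omega
    · have := hmono _ _ h.le; have := hmono _ _ h.ge; omega
    · exact Or.inl ⟨hmono _ _ h, hmono _ _ h'⟩
    · exact Or.inr ⟨hmono _ _ h, hmono _ _ h'⟩
    · exact absurd h hd.not_gt

/-- The triples of distinct linked triples with the same cell. -/
noncomputable def cellTriples [DecidableEq β] (H : Finset β) (X : β → ℝ × ℝ) (blk : β → ℕ) (p q : ℝ × ℝ × ℝ) :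
    Finset ((β × β × β) × (β × β × β) × (β × β × β)) :=
  (linkedTriples H X p q ×ˢ linkedTriples H X p q ×ˢ linkedTriples H X p q).filter fun w =>
    w.1 ≠ w.2.1 ∧ w.1 ≠ w.2.2 ∧ w.2.1 ≠ w.2.2 ∧
      (blk w.1.1, blk w.1.2.2) = (blk w.2.1.1, blk w.2.1.2.2) ∧
      (blk w.1.1, blk w.1.2.2) = (blk w.2.2.1, blk w.2.2.2.2)

lemma mem_cellTriples [DecidableEq β] {H : Finset β} {X : β → ℝ × ℝ} {blk : β → ℕ} {p q : ℝ × ℝ × ℝ}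
    {u v w : β × β × β} :
    (u, v, w) ∈ cellTriples H X blk p q ↔ (u ∈ linkedTriples H X p q ∧ v ∈ linkedTriples H X p q ∧
      w ∈ linkedTriples H X p q) ∧ u ≠ v ∧ u ≠ w ∧ v ≠ w ∧
      (blk u.1 = blk v.1 ∧ blk u.2.2 = blk v.2.2) ∧
      (blk u.1 = blk w.1 ∧ blk u.2.2 = blk w.2.2) := by
  simp [cellTriples]

/-- The first and last points of three linked triples. -/
def endpoints (w : (β × β × β) × (β × β × β) × (β × β × β)) : (β × β) × (β × β) × (β × β) :=
  ((w.1.1, w.1.2.2), (w.2.1.1, w.2.1.2.2), (w.2.2.1, w.2.2.2.2))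

/-- The possible endpoints of triples in a common cell. -/
def cellEndpoints (H : Finset β) (blk : β → ℕ) : Finset ((β × β) × (β × β) × (β × β)) :=
  ((H ×ˢ H) ×ˢ (H ×ˢ H) ×ˢ (H ×ˢ H)).filter fun e =>
    (blk e.1.1 = blk e.2.1.1 ∧ blk e.1.2 = blk e.2.1.2) ∧
      (blk e.1.1 = blk e.2.2.1 ∧ blk e.1.2 = blk e.2.2.2)

/-- The first pair of endpoints is free; the other two pairs are confined to its two blocks, which
leaves at most $s$ choices for each of four points. -/
lemma card_cellEndpoints_le [DecidableEq β] {H : Finset β} {blk : β → ℕ} {s : ℕ}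
    (hblk : ∀ j, (H.filter fun x => blk x = j).card ≤ s) :
    (cellEndpoints H blk).card ≤ s ^ 4 * H.card ^ 2 := by
  have h := Finset.card_le_mul_card_image_of_maps_to (s := cellEndpoints H blk) (t := H ×ˢ H)
    (f := fun e => e.1) (fun e he => by
      simp only [cellEndpoints, Finset.mem_filter, Finset.mem_product] at he
      exact Finset.mem_product.2 he.1.1) (s ^ 4) ?_
  · simpa [sq] using h
  rintro ⟨x, z⟩ _
  set F := fun j => H.filter fun x => blk x = j
  calc _ ≤ ((F (blk x) ×ˢ F (blk z)) ×ˢ (F (blk x) ×ˢ F (blk z))).card := by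
        refine Finset.card_le_card_of_injOn (fun e => e.2) ?_ ?_
        · rintro ⟨⟨x1, z1⟩, ⟨x2, z2⟩, ⟨x3, z3⟩⟩ he
          simp only [cellEndpoints, Finset.coe_filter, Finset.mem_filter, Finset.mem_product,
            Set.mem_ofPred_eq, Prod.mk.injEq] at he
          obtain ⟨⟨h1, h2, h3⟩, rfl, rfl⟩ := he
          simp only [F, Finset.coe_product, Finset.coe_filter, Set.mem_prod, Set.mem_ofPred_eq]
          exact ⟨⟨⟨h1.2.1.1, h2.1.symm⟩, ⟨h1.2.1.2, h2.2.symm⟩⟩,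
            ⟨⟨h1.2.2.1, h3.1.symm⟩, ⟨h1.2.2.2, h3.2.symm⟩⟩⟩
        · rintro ⟨e, e'⟩ he ⟨f, f'⟩ hf h
          simp only [Finset.coe_filter, Set.mem_ofPred_eq] at he hf h
          rw [he.2, hf.2, h]
    _ ≤ (s * s) * (s * s) := by
        rw [Finset.card_product, Finset.card_product]
        gcongr <;> exact hblk _
    _ = s ^ 4 := by ring

/-- The pairs `(P, Q)` of distinct elements of `G` together with three linked triples in a common
cell, having prescribed endpoints, are at most as many as the elements of `G` on a line. -/
lemma card_cellTriples_fiber_le [DecidableEq α] [DecidableEq β] {G : Finset α} {S : α → ℝ × ℝ × ℝ} {H : Finset β} {X : β → ℝ × ℝ}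
    {blk : β → ℕ} {m : ℕ} (hX : ∀ x ∈ H, X x ≠ 0)
    (hXX : ∀ x ∈ H, ∀ y ∈ H, x ≠ y → wedge (X x) (X y) ≠ 0)
    (hS : ∀ P ∈ G, binaryDisc (S P) ≠ 0)
    (hSS : ∀ P ∈ G, ∀ Q ∈ G, ∀ μ : ℝ, S P = μ • S Q → P = Q)
    (hm : ∀ P ∈ G, ∀ Q ∈ G, P ≠ Q → ∀ L ⊆ G, (∀ R ∈ L, det3 (S R) (S P) (S Q) = 0) → L.card ≤ m)
    (e : (β × β) × (β × β) × (β × β)) :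
    ((G.offDiag.sigma fun P => cellTriples H X blk (S P.1) (S P.2)).filter
      fun w => endpoints w.2 = e).card ≤ m := by
  set Φ := (G.offDiag.sigma fun P => cellTriples H X blk (S P.1) (S P.2)).filter
      fun w => endpoints w.2 = e with hΦ
  have hmem : ∀ {P Q : α} {w : (β × β × β) × (β × β × β) × (β × β × β)}, (⟨(P, Q), w⟩ :
      Σ _ : α × α, (β × β × β) × (β × β × β) × (β × β × β)) ∈ Φ → (P ∈ G ∧ Q ∈ G ∧ P ≠ Q) ∧
      ∃ x z y : Fin 3 → β, w = ((x 0, y 0, z 0), (x 1, y 1, z 1), (x 2, y 2, z 2)) ∧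
        e = ((x 0, z 0), (x 1, z 1), (x 2, z 2)) ∧
        (∀ i, x i ∈ H) ∧ (∀ i, y i ∈ H) ∧ (∀ i, z i ∈ H) ∧
        (∀ i, binaryPolar (S P) (X (x i)) (X (y i)) = 0) ∧
        (∀ i, binaryPolar (S Q) (X (y i)) (X (z i)) = 0) ∧
        ∀ i j, i ≠ j → wedge (X (x i)) (X (x j)) ≠ 0 := by
    rintro P Q ⟨⟨x0, y0, z0⟩, ⟨x1, y1, z1⟩, ⟨x2, y2, z2⟩⟩ h
    simp only [hΦ, Finset.mem_filter, Finset.mem_sigma, Finset.mem_offDiag, mem_cellTriples,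
      mem_linkedTriples] at h
    obtain ⟨⟨hPQ, ⟨⟨h0, p0, q0⟩, ⟨h1, p1, q1⟩, ⟨h2, p2, q2⟩⟩, n01, n02, n12, -⟩, he⟩ := h
    -- A linked triple is determined by its first point, so distinct triples have distinct first
    -- points.
    have hinj : ∀ {x y z x' y' z' : β}, x ∈ H → y ∈ H → z ∈ H → x' ∈ H → y' ∈ H → z' ∈ H →
        binaryPolar (S P) (X x) (X y) = 0 → binaryPolar (S Q) (X y) (X z) = 0 →
        binaryPolar (S P) (X x') (X y') = 0 → binaryPolar (S Q) (X y') (X z') = 0 →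
        (x, y, z) ≠ (x', y', z') → wedge (X x) (X x') ≠ 0 := by
      intro x y z x' y' z' hx hy hz hx' hy' hz' a b a' b' hne
      refine hXX _ hx _ hx' ?_
      rintro rfl
      obtain rfl := eq_of_binaryPolar hX hXX (hS P hPQ.1) hx hy hy' a a'
      obtain rfl := eq_of_binaryPolar hX hXX (hS Q hPQ.2.1) hy hz hz' b b'
      exact hne rfl
    refine ⟨hPQ, ![x0, x1, x2], ![z0, z1, z2], ![y0, y1, y2], rfl, he.symm, ?_, ?_, ?_, ?_, ?_, ?_⟩
    · intro i; fin_cases i; exacts [h0.1, h1.1, h2.1]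
    · intro i; fin_cases i; exacts [h0.2.1, h1.2.1, h2.2.1]
    · intro i; fin_cases i; exacts [h0.2.2, h1.2.2, h2.2.2]
    · intro i; fin_cases i; exacts [p0, p1, p2]
    · intro i; fin_cases i; exacts [q0, q1, q2]
    · have k01 := hinj h0.1 h0.2.1 h0.2.2 h1.1 h1.2.1 h1.2.2 p0 q0 p1 q1 n01
      have k02 := hinj h0.1 h0.2.1 h0.2.2 h2.1 h2.2.1 h2.2.2 p0 q0 p2 q2 n02
      have k12 := hinj h1.1 h1.2.1 h1.2.2 h2.1 h2.2.1 h2.2.2 p1 q1 p2 q2 n12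
      have k10 := hinj h1.1 h1.2.1 h1.2.2 h0.1 h0.2.1 h0.2.2 p1 q1 p0 q0 n01.symm
      have k20 := hinj h2.1 h2.2.1 h2.2.2 h0.1 h0.2.1 h0.2.2 p2 q2 p0 q0 n02.symm
      have k21 := hinj h2.1 h2.2.1 h2.2.2 h1.1 h1.2.1 h1.2.2 p2 q2 p1 q1 n12.symm
      intro i j hij
      fin_cases i <;> fin_cases j
      exacts [absurd rfl hij, k01, k02, k10, absurd rfl hij, k12, k20, k21, absurd rfl hij]
  rcases Φ.eq_empty_or_nonempty with h0 | ⟨⟨⟨P, Q⟩, w⟩, hw⟩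
  · rw [h0]; simp
  obtain ⟨⟨hP, hQ, hPQ⟩, x, z, y, -, he, hx, hy, hz, hp, hq, hxx⟩ := hmem hw
  have hends : ∀ {x' z' : Fin 3 → β}, e = ((x' 0, z' 0), (x' 1, z' 1), (x' 2, z' 2)) →
      x' = x ∧ z' = z := by
    intro x' z' he'
    rw [he] at he'
    simp only [Prod.mk.injEq] at he'
    obtain ⟨⟨a0, b0⟩, ⟨a1, b1⟩, ⟨a2, b2⟩⟩ := he'
    constructor
    · funext i; fin_cases i; exacts [a0.symm, a1.symm, a2.symm]
    · funext i; fin_cases i; exacts [b0.symm, b1.symm, b2.symm]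
  -- For fixed endpoints, $P$ determines the middle points, and then the composition determines $Q$.
  have hinj : Set.InjOn (fun w : Σ _ : α × α, (β × β × β) × (β × β × β) × (β × β × β) => w.1.1)
      Φ := by
    rintro ⟨⟨P', Q'⟩, w'⟩ hw' ⟨⟨P'', Q''⟩, w''⟩ hw'' h
    obtain ⟨⟨hP', hQ', -⟩, x', z', y', rfl, he', -, hy', -, hp', hq', -⟩ := hmem hw'
    obtain ⟨⟨-, hQ'', -⟩, x'', z'', y'', rfl, he'', -, hy'', -, hp'', hq'', -⟩ := hmem hw''
    simp only at h
    subst h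
    obtain ⟨rfl, rfl⟩ := hends he'
    obtain ⟨rfl, rfl⟩ := hends he''
    obtain rfl : y' = y'' := funext fun i =>
      eq_of_binaryPolar hX hXX (hS P' hP') (hx i) (hy' i) (hy'' i) (hp' i) (hp'' i)
    obtain ⟨μ, hμ⟩ := exists_smul_of_comp (hS P' hP') (hS Q'' hQ'') hxx
      (fun i => hX _ (hy' i)) (fun i => hX _ (hy' i)) (fun i => hX _ (hz i)) hp' hq' hp' hq''
    rw [hSS Q' hQ' Q'' hQ'' μ hμ]
  rw [← Finset.card_image_of_injOn hinj]
  refine hm P hP Q hQ hPQ _ ?_ ?_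
  · intro R hR
    obtain ⟨⟨⟨P', Q'⟩, w'⟩, hw', rfl⟩ := Finset.mem_image.1 hR
    exact (hmem hw').1.1
  · intro R hR
    obtain ⟨⟨⟨P', Q'⟩, w'⟩, hw', rfl⟩ := Finset.mem_image.1 hR
    obtain ⟨⟨hP', hQ', -⟩, x', z', y', -, he', -, hy', -, hp', hq', -⟩ := hmem hw'
    obtain ⟨rfl, rfl⟩ := hends he'
    exact det3_eq_zero_of_comp (hS P' hP') (hS Q' hQ') hxx (fun i => hX _ (hy i))
      (fun i => hX _ (hy' i)) (fun i => hX _ (hz i)) hp hq hp' hq'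

lemma sum_card_cellTriples_le [DecidableEq α] [DecidableEq β] {G : Finset α} {S : α → ℝ × ℝ × ℝ} {H : Finset β} {X : β → ℝ × ℝ}
    {blk : β → ℕ} {m s : ℕ} (hX : ∀ x ∈ H, X x ≠ 0)
    (hXX : ∀ x ∈ H, ∀ y ∈ H, x ≠ y → wedge (X x) (X y) ≠ 0)
    (hS : ∀ P ∈ G, binaryDisc (S P) ≠ 0)
    (hSS : ∀ P ∈ G, ∀ Q ∈ G, ∀ μ : ℝ, S P = μ • S Q → P = Q)
    (hm : ∀ P ∈ G, ∀ Q ∈ G, P ≠ Q → ∀ L ⊆ G, (∀ R ∈ L, det3 (S R) (S P) (S Q) = 0) → L.card ≤ m)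
    (hblk : ∀ j, (H.filter fun x => blk x = j).card ≤ s) :
    ∑ P ∈ G.offDiag, (cellTriples H X blk (S P.1) (S P.2)).card ≤ m * (s ^ 4 * H.card ^ 2) := by
  rw [← Finset.card_sigma]
  refine (Finset.card_le_mul_card_image_of_maps_to (t := cellEndpoints H blk)
    (f := fun w => endpoints w.2) ?_ m ?_).trans (Nat.mul_le_mul_left m (card_cellEndpoints_le hblk))
  · rintro ⟨⟨P, Q⟩, ⟨⟨x0, y0, z0⟩, ⟨x1, y1, z1⟩, ⟨x2, y2, z2⟩⟩⟩ h
    simp only [Finset.mem_sigma, mem_cellTriples, mem_linkedTriples] at h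
    obtain ⟨-, ⟨⟨h0, -⟩, ⟨h1, -⟩, ⟨h2, -⟩⟩, -, -, -, hc⟩ := h
    simp only [cellEndpoints, endpoints, Finset.mem_filter, Finset.mem_product]
    exact ⟨⟨⟨h0.1, h0.2.2⟩, ⟨h1.1, h1.2.2⟩, ⟨h2.1, h2.2.2⟩⟩, hc⟩
  · intro e _
    exact card_cellTriples_fiber_le hX hXX hS hSS hm e

/-- The incidences `(P, x, y)`: the involution of `P` takes `x` to `y`. -/
noncomputable def polarIncidences (G : Finset α) (S : α → ℝ × ℝ × ℝ) (H : Finset β)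
    (X : β → ℝ × ℝ) : Finset (α × β × β) :=
  open Classical in (G ×ˢ H ×ˢ H).filter fun w => binaryPolar (S w.1) (X w.2.1) (X w.2.2) = 0

lemma mem_polarIncidences {G : Finset α} {S : α → ℝ × ℝ × ℝ} {H : Finset β} {X : β → ℝ × ℝ}
    {w : α × β × β} : w ∈ polarIncidences G S H X ↔ (w.1 ∈ G ∧ w.2.1 ∈ H ∧ w.2.2 ∈ H) ∧
      binaryPolar (S w.1) (X w.2.1) (X w.2.2) = 0 := by
  simp [polarIncidences]

lemma sq_card_polarIncidences_le [DecidableEq β] (G : Finset α) (S : α → ℝ × ℝ × ℝ) (H : Finset β)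
    (X : β → ℝ × ℝ) :
    (polarIncidences G S H X).card ^ 2 ≤
      H.card * ∑ P ∈ G ×ˢ G, (linkedTriples H X (S P.1) (S P.2)).card := by
  set I := polarIncidences G S H X
  set D := fun y => I.filter fun w => w.2.2 = y
  have h1 : I.card = ∑ y ∈ H, (D y).card :=
    Finset.card_eq_sum_card_fiberwise fun w hw => (mem_polarIncidences.1 hw).1.2.2
  have h2 : ∑ y ∈ H, (D y).card ^ 2 ≤
      ∑ P ∈ G ×ˢ G, (linkedTriples H X (S P.1) (S P.2)).card := by
    have : ∀ y, (D y).card ^ 2 = (D y ×ˢ D y).card := fun y => by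
      rw [Finset.card_product, sq]
    simp only [this]
    rw [← Finset.card_sigma, ← Finset.card_sigma]
    -- Two incidences $(P,x,y)$ and $(Q,z,y)$ are glued at $y$; the symmetry of the polar form
    -- reverses the second.
    refine Finset.card_le_card_of_injOn
      (fun w => ⟨(w.2.1.1, w.2.2.1), (w.2.1.2.1, w.1, w.2.2.2.1)⟩) ?_ ?_
    · rintro ⟨y, ⟨P, x, y1⟩, ⟨Q, z, y2⟩⟩ h
      simp only [Finset.coe_sigma, Set.mem_sigma_iff, Finset.mem_coe, Finset.mem_product, D,
        Finset.mem_filter, I, mem_polarIncidences, mem_linkedTriples] at h ⊢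
      obtain ⟨-, ⟨⟨⟨hP, hx, hy⟩, hp⟩, rfl⟩, ⟨⟨hQ, hz, hy2⟩, hq⟩, rfl⟩ := h
      exact ⟨⟨hP, hQ⟩, ⟨hx, hy, hz⟩, hp, by rwa [binaryPolar_comm]⟩
    · rintro ⟨y, ⟨P, x, y1⟩, ⟨Q, z, y2⟩⟩ h ⟨y', ⟨P', x', y1'⟩, ⟨Q', z', y2'⟩⟩ h' he
      simp only [Finset.coe_sigma, Set.mem_sigma_iff, Finset.mem_coe, Finset.mem_product, D,
        Finset.mem_filter] at h h'
      obtain ⟨-, ⟨-, rfl⟩, ⟨-, rfl⟩⟩ := h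
      obtain ⟨-, ⟨-, rfl⟩, ⟨-, rfl⟩⟩ := h'
      simp only [Sigma.mk.injEq, Prod.mk.injEq, heq_eq_eq] at he
      obtain ⟨⟨rfl, rfl⟩, rfl, rfl, rfl⟩ := he
      rfl
  rw [h1]
  exact sq_sum_le_card_mul_sum_sq.trans (Nat.mul_le_mul_left _ h2)

/-- The main estimate: few elements of `G` on every line force few incidences. -/
lemma sq_card_polarIncidences_le_of_lines [DecidableEq α] [DecidableEq β] {G : Finset α} {S : α → ℝ × ℝ × ℝ} {H : Finset β}
    {X : β → ℝ × ℝ} {m s : ℕ} (hX : ∀ x ∈ H, X x ≠ 0)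
    (hXX : ∀ x ∈ H, ∀ y ∈ H, x ≠ y → wedge (X x) (X y) ≠ 0)
    (hS : ∀ P ∈ G, binaryDisc (S P) ≠ 0)
    (hSS : ∀ P ∈ G, ∀ Q ∈ G, ∀ μ : ℝ, S P = μ • S Q → P = Q)
    (hm : ∀ P ∈ G, ∀ Q ∈ G, P ≠ Q → ∀ L ⊆ G, (∀ R ∈ L, det3 (S R) (S P) (S Q) = 0) → L.card ≤ m)
    (hs : 0 < s) :
    (polarIncidences G S H X).card ^ 2 ≤ H.card * (G.card * H.card +
      G.card ^ 2 * (16 * (H.card / s + 1)) + m * (s ^ 4 * H.card ^ 2)) := by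
  obtain ⟨blk, hB, hmono, hblk⟩ := exists_blocks H (fun x => slopeKey (X x))
    (fun x hx y hy h => by
      by_contra hne
      exact hXX x hx y hy hne (wedge_eq_zero_of_slopeKey_eq h)) s hs
  refine (sq_card_polarIncidences_le G S H X).trans (Nat.mul_le_mul_left _ ?_)
  -- Pairs with $P=Q$ span no line and are bounded trivially.
  rw [← Finset.diag_union_offDiag, Finset.sum_union (Finset.disjoint_diag_offDiag G), add_assoc]
  refine add_le_add ?_ ?_
  · refine (Finset.sum_le_card_nsmul _ _ H.card ?_).trans (by simp)
    intro P hP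
    rw [Finset.mem_diag] at hP
    exact card_linkedTriples_le hX hXX (hS _ hP.1) (hS _ (hP.2 ▸ hP.1))
  · calc _ ≤ ∑ P ∈ G.offDiag, (16 * (H.card / s + 1) +
          (cellTriples H X blk (S P.1) (S P.2)).card) := by
          refine Finset.sum_le_sum fun P hP => ?_
          rw [Finset.mem_offDiag] at hP
          have := card_le_two_mul_add_card_triples (linkedTriples H X (S P.1) (S P.2))
            (fun w => (blk w.1, blk w.2.2)) _
            (card_cells_linkedTriples_le hX (hS _ hP.1) (hS _ hP.2.1) hB hmono)
          rw [← mul_assoc] at this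
          exact this
      _ ≤ _ := by
          rw [Finset.sum_add_distrib, Finset.sum_const, smul_eq_mul]
          refine add_le_add (Nat.mul_le_mul_right _ ?_)
            (sum_card_cellTriples_le hX hXX hS hSS hm hblk)
          rw [Finset.offDiag_card, sq]
          exact Nat.sub_le _ _

end Counting

/-! ### Coordinates adapted to the conic -/

open Matrix in
/-- The Gram determinant of `p`, `u`, `w`, where `u` and `w` are isotropic. -/
lemma gram_of_isotropic {M : Matrix (Fin 3) (Fin 3) ℝ} (hM : M.IsSymm) {u w : Fin 3 → ℝ}
    (hu : u ⬝ᵥ (M *ᵥ u) = 0) (hw : w ⬝ᵥ (M *ᵥ w) = 0) (p : Fin 3 → ℝ) :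
    M.det * (p ⬝ᵥ (crossProduct u w)) ^ 2 = 2 * (u ⬝ᵥ (M *ᵥ w)) * (p ⬝ᵥ (M *ᵥ w)) *
      (p ⬝ᵥ (M *ᵥ u)) - (u ⬝ᵥ (M *ᵥ w)) ^ 2 * (p ⬝ᵥ (M *ᵥ p)) := by
  set N : Matrix (Fin 3) (Fin 3) ℝ := ![p, u, w] with hN
  have hcomm : ∀ x y : Fin 3 → ℝ, x ⬝ᵥ (M *ᵥ y) = y ⬝ᵥ (M *ᵥ x) := by
    intro x y
    rw [dotProduct_mulVec, dotProduct_comm, ← mulVec_transpose, hM.eq]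
  have hentry : ∀ i j, (N * M * Nᵀ) i j = N i ⬝ᵥ (M *ᵥ N j) := by
    intro i j
    rw [Matrix.mul_assoc, Matrix.mul_apply_eq_vecMul]
    rfl
  have hdet : (N * M * Nᵀ).det = M.det * N.det ^ 2 := by
    rw [det_mul, det_mul, det_transpose]; ring
  have hNdet : N.det = p ⬝ᵥ (crossProduct u w) := (triple_product_eq_det p u w).symm
  rw [← hNdet, ← hdet, det_fin_three]
  simp only [hentry]
  have h0 : N 0 = p := rfl
  have h1 : N 1 = u := rfl
  have h2 : N 2 = w := rfl
  rw [h0, h1, h2, hcomm u p, hcomm w p, hcomm w u, hu, hw]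
  ring

/-- The homogeneous coordinates of a point. -/
def homVec (p : Plane) : Fin 3 → ℝ := ![p 0, p 1, 1]

lemma eq_of_homVec_eq_smul {p q : Plane} {μ : ℝ} (h : homVec p = μ • homVec q) : p = q := by
  have h2 : (1 : ℝ) = μ * 1 := by simpa [homVec] using congrFun h 2
  have hμ : μ = 1 := by linarith
  rw [hμ, one_smul] at h
  ext i
  fin_cases i
  · simpa [homVec] using congrFun h 0
  · simpa [homVec] using congrFun h 1

open Matrix in
/-- A non-degenerate conic with two points has the equation `Y² = X Z` in suitable homogeneous
coordinates. -/
lemma exists_conic_coordinates {M : Matrix (Fin 3) (Fin 3) ℝ} (hM : M.IsSymm) (hdet : M.det ≠ 0)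
    {x y : Plane} (hxy : x ≠ y) (hx : conicEval M x = 0) (hy : conicEval M y = 0) :
    ∃ L : Matrix (Fin 3) (Fin 3) ℝ, L.det ≠ 0 ∧ ∃ κ : ℝ, κ ≠ 0 ∧ ∀ p : Plane,
      (L *ᵥ homVec p) 1 ^ 2 - (L *ᵥ homVec p) 0 * (L *ᵥ homVec p) 2 = κ * conicEval M p := by
  set u := homVec x
  set w := homVec y
  have hu : u ⬝ᵥ (M *ᵥ u) = 0 := hx
  have hw : w ⬝ᵥ (M *ᵥ w) = 0 := hy
  have gram := gram_of_isotropic hM hu hw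
  set b := u ⬝ᵥ (M *ᵥ w) with hb
  have hb' : w ⬝ᵥ (M *ᵥ u) = b := by
    rw [dotProduct_mulVec, dotProduct_comm, ← mulVec_transpose, hM.eq]
  -- If $b=0$, the Gram identity at $p=u\times w$ forces $u\times w=0$, and the two points coincide.
  have hb0 : b ≠ 0 := by
    intro h
    have h1 := gram (crossProduct u w)
    rw [h] at h1
    have h2 : crossProduct u w ⬝ᵥ crossProduct u w = 0 := by
      have : M.det * (crossProduct u w ⬝ᵥ crossProduct u w) ^ 2 = 0 := by rw [h1]; ring
      simpa [hdet] using this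
    have h3 : crossProduct u w = 0 := dotProduct_self_eq_zero.1 h2
    apply hxy
    rw [cross_apply] at h3
    have e0 : x 1 - y 1 = 0 := by simpa [u, w, homVec] using congrFun h3 0
    have e1 : y 0 - x 0 = 0 := by simpa [u, w, homVec] using congrFun h3 1
    ext i
    fin_cases i
    · simp; linarith
    · simp; linarith
  -- The outer coordinates are the tangents at the two points and the middle one is their chord; the
  -- scaling turns the Gram identity into $Y^2-XZ$.
  refine ⟨![(2 * b / M.det) • (M *ᵥ w), crossProduct u w, M *ᵥ u], ?_, -b ^ 2 / M.det,
    div_ne_zero (neg_ne_zero.2 (pow_ne_zero 2 hb0)) hdet, ?_⟩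
  · have h1 : det ![(2 * b / M.det) • (M *ᵥ w), crossProduct u w, M *ᵥ u] =
        -((2 * b / M.det) * b ^ 2) := by
      rw [← triple_product_eq_det, smul_dotProduct, triple_product_permutation, cross_dot_cross,
        hu, hb', ← hb, smul_eq_mul]
      ring
    rw [h1]
    exact neg_ne_zero.2 (mul_ne_zero (div_ne_zero (by positivity) hdet) (by positivity))
  · intro p
    have h := gram (homVec p)
    have e0 : (![(2 * b / M.det) • (M *ᵥ w), crossProduct u w, M *ᵥ u] *ᵥ homVec p) 0 =
        (2 * b / M.det) * (homVec p ⬝ᵥ (M *ᵥ w)) := by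
      rw [dotProduct_comm (homVec p), ← smul_eq_mul (2 * b / M.det), ← smul_dotProduct]; rfl
    have e1 : (![(2 * b / M.det) • (M *ᵥ w), crossProduct u w, M *ᵥ u] *ᵥ homVec p) 1 =
        homVec p ⬝ᵥ crossProduct u w := by
      rw [dotProduct_comm]; rfl
    have e2 : (![(2 * b / M.det) • (M *ᵥ w), crossProduct u w, M *ᵥ u] *ᵥ homVec p) 2 =
        homVec p ⬝ᵥ (M *ᵥ u) := by
      rw [dotProduct_comm]; rfl
    have e3 : conicEval M p = homVec p ⬝ᵥ (M *ᵥ homVec p) := rfl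
    rw [e0, e1, e2, e3]
    field_simp
    linear_combination h

section Coordinates

open Matrix

variable (L : Matrix (Fin 3) (Fin 3) ℝ)

/-- The binary quadratic form attached to a point. -/
def pointForm (p : Plane) : ℝ × ℝ × ℝ :=
  ((L *ᵥ homVec p) 2, -(L *ᵥ homVec p) 1, (L *ᵥ homVec p) 0)

/-- The projective parameter of a point of the conic `Y² = X Z`. -/
noncomputable def conicParam (p : Plane) : ℝ × ℝ :=
  if (L *ᵥ homVec p) 0 = 0 then (0, (L *ᵥ homVec p) 2)
  else ((L *ᵥ homVec p) 0, (L *ᵥ homVec p) 1)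

variable {L}

lemma eq_of_mulVec_homVec (hL : L.det ≠ 0) {p q : Plane} {μ : ℝ}
    (h : L *ᵥ homVec p = μ • (L *ᵥ homVec q)) : p = q := by
  rw [← mulVec_smul] at h
  exact eq_of_homVec_eq_smul (mulVec_injective_of_isUnit
    ((isUnit_iff_isUnit_det L).2 (isUnit_iff_ne_zero.2 hL)) h)

lemma eq_of_pointForm_eq_smul (hL : L.det ≠ 0) {p q : Plane} {μ : ℝ}
    (h : pointForm L p = μ • pointForm L q) : p = q := by
  refine eq_of_mulVec_homVec hL (μ := μ) ?_
  simp only [pointForm, Prod.smul_mk, smul_eq_mul, Prod.mk.injEq] at h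
  ext i
  fin_cases i
  · exact h.2.2
  · have := h.2.1
    simp only [Fin.mk_one, Pi.smul_apply, smul_eq_mul]; linarith
  · exact h.1

lemma conicParam_spec (hL : L.det ≠ 0) {p : Plane}
    (hp : (L *ᵥ homVec p) 1 ^ 2 - (L *ᵥ homVec p) 0 * (L *ᵥ homVec p) 2 = 0) :
    conicParam L p ≠ 0 ∧ ∃ μ : ℝ, μ ≠ 0 ∧ μ * (L *ᵥ homVec p) 0 = (conicParam L p).1 ^ 2 ∧
      μ * (L *ᵥ homVec p) 1 = (conicParam L p).1 * (conicParam L p).2 ∧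
      μ * (L *ᵥ homVec p) 2 = (conicParam L p).2 ^ 2 := by
  have hne : L *ᵥ homVec p ≠ 0 := by
    intro h
    have h1 := Matrix.eq_zero_of_mulVec_eq_zero hL h
    simpa [homVec] using congrFun h1 2
  unfold conicParam
  split_ifs with h0
  · have h1 : (L *ᵥ homVec p) 1 = 0 := by simpa [h0] using hp
    have h2 : (L *ᵥ homVec p) 2 ≠ 0 := by
      intro h2
      apply hne
      ext i
      fin_cases i
      exacts [h0, h1, h2]
    refine ⟨fun h => h2 (congrArg Prod.snd h), _, h2, ?_, ?_, ?_⟩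
    · simp [h0]
    · simp [h1]
    · simp only; ring
  · refine ⟨fun h => h0 (congrArg Prod.fst h), _, h0, ?_, ?_, ?_⟩
    · simp only; ring
    · rfl
    · simp only; linarith

lemma wedge_conicParam_ne_zero (hL : L.det ≠ 0) {p q : Plane} (hpq : p ≠ q)
    (hp : (L *ᵥ homVec p) 1 ^ 2 - (L *ᵥ homVec p) 0 * (L *ᵥ homVec p) 2 = 0)
    (hq : (L *ᵥ homVec q) 1 ^ 2 - (L *ᵥ homVec q) 0 * (L *ᵥ homVec q) 2 = 0) :
    wedge (conicParam L p) (conicParam L q) ≠ 0 := by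
  intro h
  obtain ⟨-, μ, hμ, p0, p1, p2⟩ := conicParam_spec hL hp
  obtain ⟨hq0, ν, hν, q0, q1, q2⟩ := conicParam_spec hL hq
  obtain ⟨r, hr⟩ := exists_smul_of_wedge_eq_zero hq0 h
  rw [hr] at p0 p1 p2
  simp only [Prod.smul_fst, Prod.smul_snd, smul_eq_mul] at p0 p1 p2
  refine hpq (eq_of_mulVec_homVec hL (μ := r ^ 2 * ν / μ) ?_)
  ext i
  rw [Pi.smul_apply, smul_eq_mul, div_mul_eq_mul_div, eq_div_iff hμ]
  fin_cases i
  · simp only [Fin.zero_eta]; linear_combination p0 - r ^ 2 * q0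
  · simp only [Fin.mk_one]; linear_combination p1 - r ^ 2 * q1
  · simp only [Fin.reduceFinMk]; linear_combination p2 - r ^ 2 * q2

/-- The form of a point of the conic is a multiple of the square of a linear form vanishing at its
parameter, so this parameter lies in the radical. -/
lemma binaryPolar_pointForm_self (hL : L.det ≠ 0) {p : Plane}
    (hp : (L *ᵥ homVec p) 1 ^ 2 - (L *ᵥ homVec p) 0 * (L *ᵥ homVec p) 2 = 0) (y : ℝ × ℝ) :
    binaryPolar (pointForm L p) (conicParam L p) y = 0 := by
  obtain ⟨-, μ, hμ, p0, p1, p2⟩ := conicParam_spec hL hp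
  refine (mul_eq_zero.1 (?_ : μ * _ = 0)).resolve_left hμ
  simp only [binaryPolar, pointForm]
  linear_combination (conicParam L p).1 * y.1 * p2
    - ((conicParam L p).1 * y.2 + (conicParam L p).2 * y.1) * p1 + (conicParam L p).2 * y.2 * p0

/-- A point on the line of two points `x`, `y` of the conic gives a form for which the parameters of
`x` and `y` are orthogonal. -/
lemma binaryPolar_pointForm_of_mem (hL : L.det ≠ 0) {p x y : Plane} (hp : p ∈ line[ℝ, x, y])
    (hx : (L *ᵥ homVec x) 1 ^ 2 - (L *ᵥ homVec x) 0 * (L *ᵥ homVec x) 2 = 0)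
    (hy : (L *ᵥ homVec y) 1 ^ 2 - (L *ᵥ homVec y) 0 * (L *ᵥ homVec y) 2 = 0) :
    binaryPolar (pointForm L p) (conicParam L x) (conicParam L y) = 0 := by
  obtain ⟨r, rfl⟩ := mem_affineSpan_pair_iff_exists_lineMap_eq.1 hp
  have hhom : homVec (AffineMap.lineMap x y r) = (1 - r) • homVec x + r • homVec y := by
    ext i
    fin_cases i <;> simp [homVec, AffineMap.lineMap_apply] <;> ring
  have h1 := binaryPolar_pointForm_self hL hx (conicParam L y)
  have h2 := binaryPolar_pointForm_self hL hy (conicParam L x)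
  rw [binaryPolar_comm] at h2
  simp only [binaryPolar, pointForm, hhom, mulVec_add, mulVec_smul, Pi.add_apply, Pi.smul_apply,
    smul_eq_mul] at h1 h2 ⊢
  -- The form depends linearly on the homogeneous coordinates, and orthogonality holds at both ends
  -- of the chord.
  linear_combination (1 - r) * h1 + r * h2

lemma collinear_of_det3_pointForm (hL : L.det ≠ 0) {P Q : Plane} (hPQ : P ≠ Q) {s : Set Plane}
    (h : ∀ R ∈ s, det3 (pointForm L R) (pointForm L P) (pointForm L Q) = 0) : Collinear ℝ s := by
  rw [collinear_iff_exists_forall_eq_smul_vadd]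
  refine ⟨Q, P - Q, fun R hR => ?_⟩
  have hdet : det3 (pointForm L R) (pointForm L P) (pointForm L Q) =
      L.det * ((R 0 - Q 0) * (P 1 - Q 1) - (R 1 - Q 1) * (P 0 - Q 0)) := by
    simp only [det3, pointForm, homVec, det_fin_three, mulVec, dotProduct, Fin.sum_univ_three,
      cons_val_zero, cons_val_one, cons_val]
    ring
  have hkey : (R 0 - Q 0) * (P 1 - Q 1) - (R 1 - Q 1) * (P 0 - Q 0) = 0 :=
    (mul_eq_zero.1 (hdet.symm.trans (h R hR))).resolve_left hL
  by_cases h0 : P 0 = Q 0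
  · have h1 : P 1 - Q 1 ≠ 0 := by
      intro h1
      apply hPQ
      ext i
      fin_cases i
      exacts [h0, sub_eq_zero.1 h1]
    refine ⟨(R 1 - Q 1) / (P 1 - Q 1), ?_⟩
    ext i
    fin_cases i <;> simp <;> field_simp
    · linear_combination hkey
    · ring
  · have h1 : P 0 - Q 0 ≠ 0 := sub_ne_zero.2 h0
    refine ⟨(R 0 - Q 0) / (P 0 - Q 0), ?_⟩
    ext i
    fin_cases i <;> simp <;> field_simp
    · ring
    · linear_combination -hkey

end Coordinates

/-! ### Choice of constants and conclusion -/

lemma eq_line_of_mem {l : AffineSubspace ℝ Plane} (hl : IsStraightLine l) {x y : Plane}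
    (hxy : x ≠ y) (hx : x ∈ l) (hy : y ∈ l) : line[ℝ, x, y] = l := by
  have hle : line[ℝ, x, y] ≤ l := affineSpan_pair_le_of_mem_of_mem hx hy
  refine AffineSubspace.eq_of_direction_eq_of_nonempty_of_le ?_
    ⟨x, left_mem_affineSpan_pair ℝ x y⟩ hle
  refine Submodule.eq_of_le_of_finrank_eq (AffineSubspace.direction_le hle) ?_
  rw [hl.2, direction_affineSpan, vectorSpan_pair, finrank_span_singleton]
  simpa [sub_eq_zero] using hxy

/-- After division by $n^3$, the condition on $s$ bounds the term with $C^4/s$ by $n/2$. The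
constant 17 collects 1 from the diagonal pairs and 16 from the extra block; $m\ge1$ lets it be
multiplied by $m$. -/
lemma le_of_pow_four_le {C n N G m s d : ℝ} (hC : 1 < C) (hn : 0 < n) (hN0 : 0 ≤ N) (hG0 : 0 ≤ G)
    (hN : N ≤ C * n) (hG : G ≤ C * n) (hm : 1 ≤ m) (hs : 32 * C ^ 4 ≤ s) (hd0 : 0 ≤ d)
    (hd : d ≤ N / s)
    (h : n ^ 4 ≤ N * (G * N + G ^ 2 * (16 * (d + 1)) + m * (s ^ 4 * N ^ 2))) :
    1 / (2 * C ^ 3 * (17 + s ^ 4)) * n ≤ m := by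
  have hC0 : 0 < C := by linarith
  have hs0 : 0 < s := lt_of_lt_of_le (by positivity) hs
  have hd' : d ≤ C * n / s := hd.trans (by gcongr)
  have h1 : n ^ 4 ≤ (C * n) * ((C * n) * (C * n) + (C * n) ^ 2 * (16 * (C * n / s + 1))
      + m * (s ^ 4 * (C * n) ^ 2)) := h.trans (by gcongr)
  have h2 : n ^ 3 * n ≤ n ^ 3 * (C ^ 3 * (17 + m * s ^ 4) + 16 * (C ^ 4 / s) * n) := by
    have e : (C * n) * ((C * n) * (C * n) + (C * n) ^ 2 * (16 * (C * n / s + 1))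
      + m * (s ^ 4 * (C * n) ^ 2)) =
        n ^ 3 * (C ^ 3 * (17 + m * s ^ 4) + 16 * (C ^ 4 / s) * n) := by ring
    rw [← e, ← pow_succ]; exact h1
  have h3 := le_of_mul_le_mul_left h2 (by positivity)
  have h4 : C ^ 4 / s ≤ 1 / 32 := by
    rw [div_le_div_iff₀ hs0 (by norm_num)]; linarith
  have h5 : 16 * (C ^ 4 / s) * n ≤ n / 2 := by nlinarith
  have h6 : C ^ 3 * (17 + m * s ^ 4) ≤ C ^ 3 * (17 + s ^ 4) * m := by
    have : 0 < C ^ 3 := by positivity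
    nlinarith
  rw [div_mul_eq_mul_div, div_le_iff₀ (by positivity)]
  linarith

open Matrix in
theorem mainTheorem5 (C : ℝ) (hC : 1 < C) :
    ∃ c : ℝ, 0 < c ∧
      ∀ (n : ℕ) (H₁ H₂ : Finset Plane),
        (n : ℝ) ≤ (H₁.card : ℝ) → (H₁.card : ℝ) ≤ C * (n : ℝ) →
        (n : ℝ) ≤ (H₂.card : ℝ) → (H₂.card : ℝ) ≤ C * (n : ℝ) →
        (∃ Γ : Set Plane, IsNondegenerateConic Γ ∧ (H₂ : Set Plane) ⊆ Γ ∧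
          ∀ P ∈ H₁, P ∉ Γ) →
        ((n ^ 2 : ℕ) : ℕ∞) ≤ (tripleLines (H₁ : Set Plane) H₂ H₂).encard →
        ∃ S : Finset Plane, S ⊆ H₁ ∧ c * (n : ℝ) ≤ (S.card : ℝ) ∧
          Collinear ℝ (S : Set Plane) := by
  classical
  set s : ℕ := ⌈32 * C ^ 4⌉₊ with hs_def
  have hs : 32 * C ^ 4 ≤ (s : ℝ) := Nat.le_ceil _
  have hC0 : 0 < C := by linarith
  have hs0 : 0 < s := Nat.ceil_pos.2 (by positivity)
  refine ⟨1 / (2 * C ^ 3 * (17 + (s : ℝ) ^ 4)), by positivity, ?_⟩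
  intro n H₁ H₂ hn₁ hC₁ hn₂ hC₂ ⟨Γ, ⟨M, hM, hMdet, hΓ⟩, hH₂, hH₁⟩ hT
  rcases Nat.eq_zero_or_pos n with rfl | hn
  · exact ⟨∅, by simp, by simp, by simpa using collinear_empty ℝ Plane⟩
  -- One triple line supplies the two points of the conic on which the coordinates are built.
  obtain ⟨l, hl⟩ : (tripleLines (H₁ : Set Plane) H₂ H₂).Nonempty := by
    rw [← Set.encard_pos]
    exact lt_of_lt_of_le (by exact_mod_cast pow_pos hn 2) hT
  obtain ⟨-, P₀, hP₀, x₀, hx₀, y₀, hy₀, -, -, hxy₀, -⟩ := hl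
  have hconic : ∀ x ∈ H₂, conicEval M x = 0 := fun x hx => by
    have := hH₂ hx
    rwa [hΓ] at this
  have hoff : ∀ P ∈ H₁, conicEval M P ≠ 0 := fun P hP h => hH₁ P hP (by rw [hΓ]; exact h)
  obtain ⟨L, hL, κ, hκ, hLκ⟩ := exists_conic_coordinates hM hMdet hxy₀ (hconic _ hx₀) (hconic _ hy₀)
  have hon : ∀ x ∈ H₂,
      (L *ᵥ homVec x) 1 ^ 2 - (L *ᵥ homVec x) 0 * (L *ᵥ homVec x) 2 = 0 := fun x hx => by
    rw [hLκ, hconic x hx, mul_zero]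
  obtain ⟨S, hS, hmax⟩ := Finset.exists_max_image
    (H₁.powerset.filter fun S : Finset Plane => Collinear ℝ (S : Set Plane)) Finset.card
    ⟨∅, by simpa using collinear_empty ℝ Plane⟩
  rw [Finset.mem_filter, Finset.mem_powerset] at hS
  refine ⟨S, hS.1, ?_, hS.2⟩
  have hmax' : ∀ A ⊆ H₁, Collinear ℝ (A : Set Plane) → A.card ≤ S.card := fun A hA hA' =>
    hmax A (Finset.mem_filter.2 ⟨Finset.mem_powerset.2 hA, hA'⟩)
  have hS1 : 1 ≤ S.card := by
    simpa using hmax' {P₀} (by simpa using hP₀) (by simpa using collinear_singleton ℝ P₀)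
  have hcount : n ^ 2 ≤ (polarIncidences H₁ (pointForm L) H₂ (conicParam L)).card := by
    -- A triple line is recovered from its two points on the conic, so there are at least as many
    -- incidences as lines.
    have hsub : tripleLines (H₁ : Set Plane) H₂ H₂ ⊆
        (fun w : Plane × Plane × Plane => line[ℝ, w.2.1, w.2.2]) ''
          (polarIncidences H₁ (pointForm L) H₂ (conicParam L) : Set (Plane × Plane × Plane)) := by
      rintro l ⟨hl, P, hP, x, hx, y, hy, -, -, hxy, hPl, hxl, hyl⟩
      have hline := eq_line_of_mem hl hxy hxl hyl
      refine ⟨(P, x, y), Finset.mem_coe.2 (mem_polarIncidences.2 ⟨⟨hP, hx, hy⟩, ?_⟩), hline⟩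
      exact binaryPolar_pointForm_of_mem hL (hline ▸ hPl) (hon x hx) (hon y hy)
    have := hT.trans ((Set.encard_le_encard hsub).trans (Set.encard_image_le _ _))
    rw [Set.encard_coe_eq_coe_finsetCard] at this
    exact_mod_cast this
  have hmain := sq_card_polarIncidences_le_of_lines (G := H₁) (S := pointForm L) (H := H₂)
    (X := conicParam L) (m := S.card) (fun x hx => (conicParam_spec hL (hon x hx)).1)
    (fun x hx y hy hxy => wedge_conicParam_ne_zero hL hxy (hon x hx) (hon y hy))
    (fun P hP => by
      have h1 := hLκ P
      have h2 : κ * conicEval M P ≠ 0 := mul_ne_zero hκ (hoff P hP)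
      intro h
      apply h2
      rw [← h1]
      simp only [binaryDisc, pointForm] at h
      linear_combination -h)
    (fun P _ Q _ μ h => eq_of_pointForm_eq_smul hL h)
    (fun P _ Q _ hPQ A hA h => hmax' A hA (collinear_of_det3_pointForm hL hPQ fun R hR => h R hR))
    hs0
  have hfour : n ^ 4 ≤ _ := (by rw [← pow_mul] : n ^ 4 = (n ^ 2) ^ 2).le.trans
    ((Nat.pow_le_pow_left hcount 2).trans hmain)
  refine le_of_pow_four_le hC (by exact_mod_cast hn) (Nat.cast_nonneg H₂.card)
    (Nat.cast_nonneg H₁.card) hC₂ hC₁ (by exact_mod_cast hS1) hs (Nat.cast_nonneg (H₂.card / s))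
    Nat.cast_div_le ?_
  exact_mod_cast hfour
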